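/- There is an absolute constant $C$ such that the following holds. Let $L$ be a natural number and let $p\in\mathbb{Z}[x]$ be a polynomial of degree $d$ all of whose coefficients have absolute value less than $2^L$. Assume that $p$ and $p'$ are both square-free as polynomials over $\mathbb{C}$ (that is, both are nonzero and neither has a multiple complex root). For a closed axis-aligned square $S\subset\mathbb{C}$ let $m(S)$ be its midpoint and $\operatorname{diam}(S)$ its diameter ($\sqrt2$ times its side length). Call $S$ *terminal* for SqFreeCEVAL (the version, with $p'$ square-free, of the complex root isolation algorithm CEVAL that uses the 8-point test) if either $$p(m(S))\ne 0\quad\text{and}\quad\sum_{k=1}^{d}\left|\frac{p^{(k)}(m(S))}{k!\,p(m(S))}\right|\left(\frac{\operatorname{diam}(S)}{2}\right)^k<1,$$ or $p'(m(S))\neq 0$ and $$\sum_{k=1}^{d-1}\left|\frac{p^{(k+1)}(m(S))}{k!\,p'(m(S))}\right|(2\operatorname{diam}(S))^k<\frac16\quad\text{and}\quad\sum_{k=1}^{d-1}\left|\frac{p^{(k+1)}(m(S))}{k!\,p'(m(S))}\right|(4\operatorname{diam}(S))^k<\frac1{\sqrt2}.$$ The algorithm starts with the benchmark square $[-2^L,2^L]\times[-2^L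 i,2^L i]$ and repeatedly bisects each non-terminal square into its four congruent quadrants, until all squares are terminal. (In the second case the 8-point test is applied to decide whether a root is present; it causes no subdivision.) Then the algorithm terminates, and its subdivision tree, whose nodes are all the squares that occur, has at most $C\,d^2(L+\ln d)$ nodes. -/

import Mathlib

open Polynomial

noncomputable section

namespace CEval

/-- The closed axis-aligned square `[re, re + width] × [im, im + width]i` in the complex plane. -/
@[ext]
structure Square where
  re : ℝ
  im : ℝ
  width : ℝ

namespace Square

/-- The midpoint `m(S)`. -/
def mid (S : Square) : ℂ := ⟨S.re + S.width / 2, S.im + S.width / 2⟩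

/-- The diameter `diam(S) = √2 · w`. -/
def diam (S : Square) : ℝ := √2 * S.width

/-- The four squares obtained by bisecting both defining intervals. -/
def children (S : Square) : Set Square :=
  {⟨S.re, S.im, S.width / 2⟩,
   ⟨S.re + S.width / 2, S.im, S.width / 2⟩,
   ⟨S.re, S.im + S.width / 2, S.width / 2⟩,
   ⟨S.re + S.width / 2, S.im + S.width / 2, S.width / 2⟩}

/-- The benchmark square `[-2^L, 2^L] × [-2^L, 2^L]i`. -/
def benchmark (L : ℕ) : Square := ⟨-2 ^ L, -2 ^ L, 2 ^ (L + 1)⟩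

end Square

/-- The nodes of the subdivision tree of the bisection algorithm with predicate `B` started on `R`:
the root is `R`, and a node on which `B` fails is bisected, its four children being nodes. Nodes on
which `B` holds are leaves. If `R` has positive width, different positions in the tree carry
different squares, so that the tree is faithfully described by its set of nodes. -/
inductive IsNode (B : Square → Prop) (R : Square) : Square → Prop
  | root : IsNode B R R
  | child {S T : Square} : IsNode B R S → ¬ B S → T ∈ S.children → IsNode B R T

/-- The set of all nodes (internal nodes and leaves) of the subdivision tree. -/
def subdivisionTree (B : Square → Prop) (R : Square) : Set Square := {S | IsNode B R S}

/-- The test `∑_{k=1}^{deg f} |f^{(k)}(m) / (k! f(m))| r^k < K`; it fails when `f(m) = 0`. -/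
def taylorTest (f : ℂ[X]) (m : ℂ) (r K : ℝ) : Prop :=
  f.eval m ≠ 0 ∧
    ∑ k ∈ Finset.Icc 1 f.natDegree,
      ‖(derivative^[k] f).eval m / ((k.factorial : ℂ) * f.eval m)‖ * r ^ k < K

/-- The SqFreeCEVAL predicate: `S` is terminal if the exclusion test for `p` holds, or if both
tests for `p'` hold (after which the 8-point test, which causes no subdivision, decides whether
there is a root). -/
def sqFreeCEVAL (p : ℂ[X]) (S : Square) : Prop :=
  taylorTest p S.mid (S.diam / 2) 1 ∨
    (taylorTest (derivative p) S.mid (2 * S.diam) (1 / 6) ∧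
      taylorTest (derivative p) S.mid (4 * S.diam) (1 / √2))

end CEval

end

/-! The proof is by continuous amortization. Suppose a continuous `F` is at least `4 / w²` on every
nonterminal square of width `w`. Then each child of such a square carries integral at least 1, and
the tree has at most `2 ∫ F - 1` nodes as soon as the integral over the root square is at least 1.

Both tests follow from an upper bound on the radius times the sum of inverse distances from the
midpoint to the roots of the tested polynomial. Let `s i ≤ 1/d` bound the distance from `α i` to the
other roots from below. A square near `α i` compared with `ρ i = s i / (30 d²)` passes the tests for
`p'`, because no critical point lies within `s i / d` of `α i`. Away from all roots, Cauchy–Schwarz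
turns the exclusion test into a condition on `d ∑ |z - α i|⁻²`. Truncating the distances at `ρ i`
gives `F z = 64 d ∑ (max |z - α i| (ρ i))⁻²`.

Each summand integrates to `O(L + log d - log (s i))` by dyadic summation. A Davenport–Mahler
argument gives `-∑ log (s i) = O(d (L + log d))`: the discriminant of an integer polynomial is at
least 1 in absolute value, while close pairs of roots make the Vandermonde determinant small. The
factor `d` in `F`, the price of Cauchy–Schwarz, then yields `d²`. -/

namespace CEval

/-! ### Taylor tests and sums of inverse distances to the roots -/

/-- The roots of a complex polynomial, with multiplicity, listed by `Fin f.natDegree`. -/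
lemma exists_fin_roots (f : ℂ[X]) : ∃ α : Fin f.natDegree → ℂ,
    f.roots = Finset.univ.val.map α ∧ f = C f.leadingCoeff * ∏ i, (X - C (α i)) := by
  have hs := IsAlgClosed.splits f
  obtain ⟨l, hl⟩ : ∃ l : List ℂ, f.roots = l := ⟨f.roots.toList, (Multiset.coe_toList _).symm⟩
  have hlen : l.length = f.natDegree := by
    rw [hs.natDegree_eq_card_roots, hl, Multiset.coe_card]
  have h : f.roots = Finset.univ.val.map (fun i : Fin f.natDegree => l.get (i.cast hlen.symm)) := by
    rw [hl, Fin.univ_val_map, ← List.ofFn_congr hlen, List.ofFn_get]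
  refine ⟨_, h, ?_⟩
  conv_lhs => rw [hs.eq_prod_roots, h, Multiset.map_map]
  rfl

lemma injective_of_squarefree {f : ℂ[X]} (hf : Squarefree f) {ι : Type*} [Fintype ι] {α : ι → ℂ}
    (h : f.roots = Finset.univ.val.map α) : Function.Injective α := by
  have hn : f.roots.Nodup := nodup_roots (PerfectField.separable_iff_squarefree.mpr hf)
  rw [h] at hn
  exact fun i j hij => Multiset.inj_on_of_nodup_map hn i (Finset.mem_univ_val i) j
    (Finset.mem_univ_val j) hij

variable {ι : Type*} [Fintype ι]

lemma coeff_prod_one_add_C_mul_X (c : ι → ℂ) (k : ℕ) :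
    (∏ i, (1 + C (c i) * X)).coeff k =
      ∑ t : Finset ι, if k = t.card then ∏ i ∈ t, c i else 0 := by
  classical
  rw [Finset.prod_one_add, finsetSum_coeff, Finset.powerset_univ]
  refine Finset.sum_congr rfl fun t _ => ?_
  rw [Finset.prod_mul_distrib, Finset.prod_const, ← map_prod, coeff_C_mul, coeff_X_pow]
  simp

/-- Taking norms in the elementary symmetric functions bounds the sum by `∏ (1 + r ‖c i‖) - 1`, the
1 being the empty subset, and `1 + x ≤ exp x`. -/
lemma sum_norm_coeff_prod_le (c : ι → ℂ) {r : ℝ} (hr : 0 ≤ r) (n : ℕ) :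
    ∑ k ∈ Finset.Icc 1 n, ‖(∏ i, (1 + C (c i) * X)).coeff k‖ * r ^ k ≤
      Real.exp (r * ∑ i, ‖c i‖) - 1 := by
  classical
  have key : ∑ k ∈ Finset.Icc 1 n, ‖(∏ i, (1 + C (c i) * X)).coeff k‖ * r ^ k ≤
      ∑ t : Finset ι, if t = ∅ then 0 else ∏ i ∈ t, (r * ‖c i‖) := by
    calc _ ≤ ∑ k ∈ Finset.Icc 1 n, ∑ t : Finset ι,
          if k = t.card then ∏ i ∈ t, (r * ‖c i‖) else 0 := by
          refine Finset.sum_le_sum fun k _ => ?_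
          rw [coeff_prod_one_add_C_mul_X]
          refine (mul_le_mul_of_nonneg_right (norm_sum_le _ _) (by positivity)).trans ?_
          rw [Finset.sum_mul]
          refine Finset.sum_le_sum fun t _ => ?_
          split_ifs with h
          · rw [Finset.prod_mul_distrib, Finset.prod_const, norm_prod, h, mul_comm]
          · simp
      _ ≤ _ := by
          rw [Finset.sum_comm]
          refine Finset.sum_le_sum fun t _ => ?_
          have hp : 0 ≤ ∏ i ∈ t, (r * ‖c i‖) := Finset.prod_nonneg fun i _ => by positivity
          rw [Finset.sum_ite_eq']
          split_ifs with h1 h2 h2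
          · simp [h2] at h1
          · exact le_rfl
          · exact le_rfl
          · exact hp
  have h1 : ∑ t : Finset ι, (if t = ∅ then 0 else ∏ i ∈ t, (r * ‖c i‖)) =
      ∏ i, (1 + r * ‖c i‖) - 1 := by
    rw [Finset.prod_one_add, Finset.powerset_univ, eq_sub_iff_add_eq,
      ← Finset.sum_erase_add _ _ (Finset.mem_univ (∅ : Finset ι)),
      ← Finset.sum_erase_add _ _ (Finset.mem_univ (∅ : Finset ι))]
    simp only [if_true, add_zero, Finset.prod_empty]
    congr 1
    exact Finset.sum_congr rfl fun t ht => if_neg (Finset.ne_of_mem_erase ht)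
  rw [h1] at key
  refine key.trans (sub_le_sub_right ?_ 1)
  rw [Finset.mul_sum, Real.exp_sum]
  refine Finset.prod_le_prod (fun i _ => by positivity) fun i _ => ?_
  rw [add_comm]; exact Real.add_one_le_exp _

/-- Normalised by `f.eval m`, the Taylor expansion of `f` at `m` is `∏ (1 + X / (m - α i))`, so the
tested quantities are the norms of its coefficients. -/
lemma taylorTest_of_sum_lt {f : ℂ[X]} {a : ℂ} (ha : a ≠ 0) {α : ι → ℂ}
    (hf : f = C a * ∏ i, (X - C (α i))) {m : ℂ} (hm : ∀ i, m ≠ α i) {r K : ℝ} (hr : 0 ≤ r)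
    (h : Real.exp (r * ∑ i, ‖m - α i‖⁻¹) < 1 + K) : taylorTest f m r K := by
  have hev : f.eval m = a * ∏ i, (m - α i) := by
    rw [hf, eval_mul, eval_C, eval_prod]; simp
  have hne : f.eval m ≠ 0 := by
    rw [hev]
    exact mul_ne_zero ha (Finset.prod_ne_zero_iff.mpr fun i _ => sub_ne_zero.mpr (hm i))
  refine ⟨hne, ?_⟩
  have htay : taylor m f = C (f.eval m) * ∏ i, (1 + C ((m - α i)⁻¹) * X) := by
    have : ∀ i, taylor m (X - C (α i)) = C (m - α i) * (1 + C ((m - α i)⁻¹) * X) := fun i => by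
      rw [map_sub, taylor_X, taylor_C, mul_add, ← mul_assoc, ← C_mul,
        mul_inv_cancel₀ (sub_ne_zero.mpr (hm i)), C_sub, C_1]
      ring
    have e : taylor m (∏ i, (X - C (α i))) = ∏ i, taylor m (X - C (α i)) :=
      map_prod (taylorAlgHom m) _ _
    rw [hev, C_mul, map_prod, mul_assoc, ← Finset.prod_mul_distrib]
    conv_lhs => rw [hf, taylor_mul, taylor_C, e]
    simp_rw [this]
  have hco : ∀ k, (derivative^[k] f).eval m / ((k.factorial : ℂ) * f.eval m) =
      (∏ i, (1 + C ((m - α i)⁻¹) * X)).coeff k := fun k => by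
    have h1 : (derivative^[k] f).eval m = (k.factorial : ℂ) * (taylor m f).coeff k := by
      rw [taylor_coeff, ← factorial_smul_hasseDeriv]
      simp
    have h2 : (k.factorial : ℂ) ≠ 0 := by exact_mod_cast k.factorial_ne_zero
    rw [h1, htay, coeff_C_mul]
    field_simp
  simp_rw [hco]
  have := sum_norm_coeff_prod_le (fun i => (m - α i)⁻¹) hr f.natDegree
  simp_rw [norm_inv] at this
  linarith

/-! ### Distance from roots to critical points -/

/-- Critical points keep a distance from simple roots. -/
lemma dist_critical_point {f : ℂ[X]} {a : ℂ} (ha : a ≠ 0) {d : ℕ} {α : Fin d → ℂ}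
    (hf : f = C a * ∏ i, (X - C (α i))) {i : Fin d} {s : ℝ}
    (hs : 0 < s) (hsi : ∀ k ≠ i, s ≤ ‖α i - α k‖) {β : ℂ} (hβ : (derivative f).eval β = 0) :
    s / d ≤ ‖β - α i‖ := by
  classical
  have hd : 0 < d := i.pos
  have hd' : (1 : ℝ) ≤ d := by exact_mod_cast hd
  by_contra! hlt
  have hsd : s / d ≤ s := div_le_self hs.le hd'
  have hder : (derivative f).eval β =
      a * ∑ j, ∏ k ∈ Finset.univ.erase j, (β - α k) := by
    rw [hf, derivative_mul, derivative_C, derivative_prod_finset]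
    simp [eval_finsetSum, eval_prod]
  have hfar : ∀ k ≠ i, s - s / d < ‖β - α k‖ := fun k hk => by
    have h1 := hsi k hk
    have h2 : ‖α i - α k‖ ≤ ‖β - α i‖ + ‖β - α k‖ := by
      rw [norm_sub_rev β (α i), ← sub_add_sub_cancel (α i) β (α k)]
      exact norm_add_le _ _
    linarith
  have hk0 : ∀ k ≠ i, β - α k ≠ 0 := fun k hk h0 => by
    have := hfar k hk
    rw [h0, norm_zero] at this
    linarith
  have hprod : ∏ k ∈ Finset.univ.erase i, (β - α k) ≠ 0 :=
    Finset.prod_ne_zero_iff.mpr fun k hk => hk0 k (Finset.ne_of_mem_erase hk)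
  have hsum : ∑ j, ∏ k ∈ Finset.univ.erase j, (β - α k) = 0 := by
    simpa [hder, ha] using hβ
  have hi0 : β - α i ≠ 0 := fun h0 => by
    rw [← Finset.add_sum_erase _ _ (Finset.mem_univ i), Finset.sum_eq_zero (s := Finset.univ.erase i),
      add_zero] at hsum
    · exact hprod hsum
    · intro j hj
      exact Finset.prod_eq_zero (Finset.mem_erase.mpr
        ⟨(Finset.ne_of_mem_erase hj).symm, Finset.mem_univ i⟩) h0
  have hall : ∀ k, β - α k ≠ 0 := fun k => by
    by_cases hk : k = i
    · rwa [hk]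
    · exact hk0 k hk
  -- The logarithmic derivative vanishes at `β`. If `β` were too close to `α i`, the `i`-th term
  -- would exceed `d / s`, while the other `d - 1` terms, each at most `1 / (s - s/d)`, add up to at
  -- most `d / s`.
  have hinv : ∑ j, (β - α j)⁻¹ = 0 := by
    have e : ∑ j, ∏ k ∈ Finset.univ.erase j, (β - α k) =
        (∏ k, (β - α k)) * ∑ j, (β - α j)⁻¹ := by
      rw [Finset.mul_sum]
      refine Finset.sum_congr rfl fun j _ => ?_
      rw [← Finset.mul_prod_erase _ _ (Finset.mem_univ j)]
      field_simp [hall j]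
    rw [e] at hsum
    exact (mul_eq_zero.mp hsum).resolve_left (Finset.prod_ne_zero_iff.mpr fun k _ => hall k)
  rw [← Finset.add_sum_erase _ _ (Finset.mem_univ i), add_eq_zero_iff_eq_neg] at hinv
  have hle : ‖β - α i‖⁻¹ ≤ ∑ j ∈ Finset.univ.erase i, ‖β - α j‖⁻¹ := by
    rw [← norm_inv, hinv, norm_neg]
    exact (norm_sum_le _ _).trans (by simp_rw [norm_inv]; exact le_rfl)
  have hipos : 0 < ‖β - α i‖ := norm_pos_iff.mpr hi0
  have hbig : (d : ℝ) / s < ‖β - α i‖⁻¹ := by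
    rw [lt_inv_comm₀ (by positivity) hipos, inv_div]; exact hlt
  have hsmall : ∑ j ∈ Finset.univ.erase i, ‖β - α j‖⁻¹ ≤ d / s := by
    rcases Nat.lt_or_ge 1 d with h1 | h1
    · have h1' : (1 : ℝ) < d := by exact_mod_cast h1
      have hpos : 0 < s - s / d := by
        have : s / d < s := div_lt_self hs h1'
        linarith
      calc _ ≤ ∑ j ∈ Finset.univ.erase i, (s - s / d)⁻¹ :=
            Finset.sum_le_sum fun j hj =>
              inv_anti₀ hpos (hfar j (Finset.ne_of_mem_erase hj)).le
        _ = d / s := by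
            rw [Finset.sum_const, Finset.card_erase_of_mem (Finset.mem_univ i), Finset.card_univ,
              Fintype.card_fin, nsmul_eq_mul, Nat.cast_sub hd]
            have : (d : ℝ) - 1 ≠ 0 := by linarith
            have e : s - s / d = s * (d - 1) / d := by field_simp
            rw [e]
            push_cast
            field_simp
    · have : (Finset.univ : Finset (Fin d)).erase i = ∅ := by
        rw [← Finset.card_eq_zero, Finset.card_erase_of_mem (Finset.mem_univ i), Finset.card_univ,
              Fintype.card_fin]
        omega
      rw [this, Finset.sum_empty]; positivity
  linarith

/-! ### Davenport–Mahler bound for the separations -/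

lemma norm_det_le_factorial_mul_prod {n : Type*} [Fintype n] [DecidableEq n] (M : Matrix n n ℂ)
    {b : n → ℝ} (h : ∀ i j, ‖M i j‖ ≤ b i) :
    ‖M.det‖ ≤ (Fintype.card n).factorial * ∏ i, b i := by
  -- The crude Leibniz expansion suffices: only `log d! ≤ d log d` enters later. Transposing makes
  -- each product run over the rows.
  rw [← Matrix.det_transpose, Matrix.det_apply]
  refine (norm_sum_le _ _).trans ?_
  have : ∀ σ ∈ (Finset.univ : Finset (Equiv.Perm n)),
      ‖Equiv.Perm.sign σ • ∏ i, M.transpose (σ i) i‖ ≤ ∏ i, b i := fun σ _ => by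
    rw [Units.smul_def, ← Int.cast_smul_eq_zsmul ℂ, norm_smul, norm_prod]
    have : ‖(((Equiv.Perm.sign σ : ℤˣ) : ℤ) : ℂ)‖ = 1 := by
      rcases Int.units_eq_one_or (Equiv.Perm.sign σ) with h | h <;> simp [h]
    rw [this, one_mul]
    exact Finset.prod_le_prod (fun i _ => norm_nonneg _) fun i _ => h i (σ i)
  refine (Finset.sum_le_card_nsmul _ _ _ this).trans ?_
  rw [Finset.card_univ, Fintype.card_perm, nsmul_eq_mul]

lemma norm_pow_le_of_close {d k : ℕ} (hk : k ≤ d) {x y : ℂ} (h : ‖x - y‖ ≤ 1 / d) (hd : 0 < d) :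
    ‖y‖ ^ k ≤ Real.exp 1 * max 1 ‖x‖ ^ k := by
  have hm : (1 : ℝ) ≤ max 1 ‖x‖ := le_max_left _ _
  have hy : ‖y‖ ≤ max 1 ‖x‖ * (1 + 1 / d) := by
    have h1 : ‖y‖ ≤ ‖x‖ + ‖x - y‖ := by
      rw [norm_sub_rev]
      simpa using norm_add_le x (y - x)
    have h2 : ‖x‖ ≤ max 1 ‖x‖ := le_max_right _ _
    have h3 : (1 : ℝ) / d ≤ max 1 ‖x‖ * (1 / d) := le_mul_of_one_le_left (by positivity) hm
    linarith
  have he : (1 + 1 / (d : ℝ)) ^ k ≤ Real.exp 1 := by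
    have h1 : (1 + 1 / (d : ℝ)) ≤ Real.exp (1 / d) := by
      rw [add_comm]; exact Real.add_one_le_exp _
    calc (1 + 1 / (d : ℝ)) ^ k ≤ (1 + 1 / (d : ℝ)) ^ d :=
          pow_le_pow_right₀ (by simp) hk
      _ ≤ Real.exp (1 / d) ^ d := by gcongr
      _ = Real.exp 1 := by
          rw [← Real.exp_nat_mul]
          congr 1
          field_simp
  calc ‖y‖ ^ k ≤ (max 1 ‖x‖ * (1 + 1 / d)) ^ k := by gcongr
    _ = (1 + 1 / (d : ℝ)) ^ k * max 1 ‖x‖ ^ k := by rw [mul_pow, mul_comm]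
    _ ≤ _ := by gcongr

lemma norm_pow_sub_pow_le {d k : ℕ} (hk : k < d) {x y : ℂ} (h : ‖x - y‖ ≤ 1 / d) :
    ‖x ^ k - y ^ k‖ ≤ ‖x - y‖ * (d * Real.exp 1 * max 1 ‖x‖ ^ (d - 1)) := by
  have hm : (1 : ℝ) ≤ max 1 ‖x‖ := le_max_left _ _
  rw [← geom_sum₂_mul, norm_mul, mul_comm]
  refine mul_le_mul_of_nonneg_left ((norm_sum_le _ _).trans ?_) (norm_nonneg _)
  have hterm : ∀ i ∈ Finset.range k, ‖x ^ i * y ^ (k - 1 - i)‖ ≤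
      Real.exp 1 * max 1 ‖x‖ ^ (d - 1) := fun i hi => by
    have hi' := Finset.mem_range.mp hi
    rw [norm_mul, norm_pow, norm_pow]
    calc ‖x‖ ^ i * ‖y‖ ^ (k - 1 - i) ≤
        max 1 ‖x‖ ^ i * (Real.exp 1 * max 1 ‖x‖ ^ (k - 1 - i)) := by
          gcongr
          · exact le_max_right _ _
          · exact norm_pow_le_of_close (by omega) h (by omega)
      _ = Real.exp 1 * max 1 ‖x‖ ^ (k - 1) := by
          rw [mul_left_comm, ← pow_add]
          congr 3
          omega
      _ ≤ _ := by
          gcongr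
  refine (Finset.sum_le_card_nsmul _ _ _ hterm).trans ?_
  rw [Finset.card_range, nsmul_eq_mul, ← mul_assoc]
  gcongr

/-- A Davenport–Mahler type bound: pairs of close roots, along an acyclic graph. -/
lemma norm_det_vandermonde_le {d : ℕ} (α : Fin d → ℂ) (I : Finset (Fin d)) (n : Fin d → Fin d)
    (hn : (∀ i ∈ I, n i < i) ∨ (∀ i ∈ I, i < n i)) (hI : ∀ i ∈ I, ‖α i - α (n i)‖ ≤ 1 / d)
    (hα : ∀ i ∈ I, α i ≠ α (n i)) :
    ‖(Matrix.vandermonde α).det‖ ≤ (∏ i ∈ I, ‖α i - α (n i)‖) *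
      (d.factorial * ∏ i, (d * Real.exp 1 * max 1 ‖α i‖ ^ (d - 1))) := by
  classical
  have hne : ∀ i ∈ I, n i ≠ i := fun i hi h => hα i hi (by rw [h])
  -- `T` subtracts row `n i` from row `i` for `i ∈ I`. Since `n` moves all of `I` in one direction,
  -- `T` is unitriangular, and each changed row has `‖α i - α (n i)‖` as a factor in its bound.
  let T : Matrix (Fin d) (Fin d) ℂ := fun i j =>
    if i = j then 1 else if i ∈ I ∧ j = n i then -1 else 0
  have hT : T.det = 1 := by
    rcases hn with hn | hn
    · rw [Matrix.det_of_isLowerTriangular T]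
      · simp [T]
      · intro i j hij
        have hij' : i < j := hij
        have h2 : ¬ (i ∈ I ∧ j = n i) := fun ⟨h1, h2⟩ => by
          have := hn i h1
          omega
        simp [T, hij'.ne, h2]
    · rw [Matrix.det_of_isUpperTriangular]
      · simp [T]
      · intro i j hij
        have hij' : j < i := hij
        have h2 : ¬ (i ∈ I ∧ j = n i) := fun ⟨h1, h2⟩ => by
          have := hn i h1
          omega
        simp [T, hij'.ne', h2]
  have hTV : ∀ i j, (T * Matrix.vandermonde α) i j =
      if i ∈ I then α i ^ (j : ℕ) - α (n i) ^ (j : ℕ) else α i ^ (j : ℕ) := fun i j => by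
    have e : ∀ k, T i k * Matrix.vandermonde α k j =
        (if i = k then α k ^ (j : ℕ) else 0) -
          if k = n i then (if i ∈ I then α k ^ (j : ℕ) else 0) else 0 := fun k => by
      simp only [T, Matrix.vandermonde_apply]
      by_cases hik : i = k
      · subst hik
        by_cases hi : i ∈ I
        · simp [(hne i hi).symm]
        · simp [hi]
      · by_cases hk : k = n i <;> by_cases hi : i ∈ I <;> simp [hik, hk, hi]
        all_goals simp_all
    rw [Matrix.mul_apply]
    simp_rw [e]
    rw [Finset.sum_sub_distrib, Finset.sum_ite_eq, Finset.sum_ite_eq']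
    by_cases hi : i ∈ I <;> simp [hi]
  have hdet : (Matrix.vandermonde α).det = (T * Matrix.vandermonde α).det := by
    rw [Matrix.det_mul, hT, one_mul]
  rw [hdet]
  have hb := norm_det_le_factorial_mul_prod (T * Matrix.vandermonde α)
    (b := fun i => (if i ∈ I then ‖α i - α (n i)‖ else 1) *
      (d * Real.exp 1 * max 1 ‖α i‖ ^ (d - 1))) ?_
  · refine hb.trans_eq ?_
    rw [Finset.prod_mul_distrib, Fintype.card_fin, Finset.prod_ite_mem, Finset.univ_inter]
    ring
  · intro i j
    rw [hTV]
    have hd : (1 : ℝ) ≤ d := by exact_mod_cast i.pos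
    have hm : (1 : ℝ) ≤ max 1 ‖α i‖ := le_max_left _ _
    split_ifs with hi
    · exact norm_pow_sub_pow_le j.2 (hI i hi)
    · rw [norm_pow, one_mul]
      calc ‖α i‖ ^ (j : ℕ) ≤ max 1 ‖α i‖ ^ (j : ℕ) := by gcongr; exact le_max_right _ _
        _ ≤ max 1 ‖α i‖ ^ (d - 1) := pow_le_pow_right₀ hm (by omega)
        _ ≤ d * Real.exp 1 * max 1 ‖α i‖ ^ (d - 1) := by
            refine le_mul_of_one_le_left (by positivity) ?_
            exact one_le_mul_of_one_le_of_one_le hd (Real.one_le_exp zero_le_one)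

/-- The resultant of an integer polynomial and its derivative bounds the Vandermonde determinant
of the roots from below. -/
lemma one_le_leadingCoeff_mul_det_vandermonde {p : ℤ[X]} {d : ℕ} (hd : p.natDegree = d)
    {α : Fin d → ℂ} (hp : d ≠ 0)
    (hr : (p.map (Int.castRingHom ℂ)).roots = Finset.univ.val.map α)
    (hf : p.map (Int.castRingHom ℂ) = C (p.leadingCoeff : ℂ) * ∏ i, (X - C (α i)))
    (hα : Function.Injective α) :
    1 ≤ |(p.leadingCoeff : ℝ)| ^ (2 * d - 1) * ‖(Matrix.vandermonde α).det‖ ^ 2 := by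
  classical
  set f := p.map (Int.castRingHom ℂ) with hfdef
  set a : ℂ := (p.leadingCoeff : ℂ) with ha
  have ha0 : a ≠ 0 := by
    rw [ha, Int.cast_ne_zero, leadingCoeff_ne_zero]
    rintro rfl
    exact hp (hd.symm.trans natDegree_zero)
  have hnd : f.natDegree = d :=
    (natDegree_map_eq_of_injective (RingHom.injective_int _) p).trans hd
  have hlc : f.leadingCoeff = a := by
    rw [hfdef, leadingCoeff_map_of_injective (RingHom.injective_int _)]; rfl
  have hev : ∀ i, (derivative f).eval (α i) = a * ∏ k ∈ Finset.univ.erase i, (α i - α k) := by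
    intro i
    rw [hf, derivative_mul, derivative_C, derivative_prod_finset]
    simp only [zero_mul, zero_add, eval_mul, eval_C, eval_finsetSum, eval_prod]
    congr 1
    rw [Finset.sum_eq_single i]
    · simp
    · intro j _ hj
      exact mul_eq_zero_of_left (Finset.prod_eq_zero
        (Finset.mem_erase.mpr ⟨hj.symm, Finset.mem_univ i⟩) (by simp)) _
    · simp
  -- The resultant is an integer, nonzero because the roots are distinct, so its norm is at least 1.
  have hres : ((resultant p (derivative p) d (d - 1) : ℤ) : ℂ) =
      a ^ (2 * d - 1) * ∏ i, ∏ k ∈ Finset.univ.erase i, (α i - α k) := by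
    have h1 := resultant_eq_prod_eval f (derivative f) (d - 1)
      ((natDegree_derivative_le f).trans (by rw [hnd])) (IsAlgClosed.splits f)
    rw [hr, hlc, Multiset.map_map, hnd] at h1
    have h2 := resultant_map_map p (derivative p) d (d - 1) (Int.castRingHom ℂ)
    rw [← derivative_map] at h2
    rw [← hfdef, h1] at h2
    refine Eq.trans h2.symm ?_
    change a ^ (d - 1) * ∏ i, (derivative f).eval (α i) = _
    simp_rw [hev]
    rw [Finset.prod_mul_distrib, Finset.prod_const, Finset.card_univ, Fintype.card_fin, ← mul_assoc,
      ← pow_add]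
    congr 2
    omega
  have hne : resultant p (derivative p) d (d - 1) ≠ 0 := by
    rw [← Int.cast_ne_zero (α := ℂ), hres]
    refine mul_ne_zero (pow_ne_zero _ ha0) (Finset.prod_ne_zero_iff.mpr fun i _ =>
      Finset.prod_ne_zero_iff.mpr fun k hk => sub_ne_zero.mpr fun h => ?_)
    exact Finset.ne_of_mem_erase hk (hα h.symm)
  have hone : 1 ≤ ‖((resultant p (derivative p) d (d - 1) : ℤ) : ℂ)‖ := by
    rw [Complex.norm_intCast]
    exact_mod_cast Int.one_le_abs hne
  have hV : ∏ i, ∏ k ∈ Finset.univ.erase i, ‖α i - α k‖ = ‖(Matrix.vandermonde α).det‖ ^ 2 := by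
    rw [Matrix.det_vandermonde, norm_prod]
    simp_rw [norm_prod]
    have e : ∀ i : Fin d, ∏ k ∈ Finset.univ.erase i, ‖α i - α k‖ =
        (∏ k ∈ Finset.Ioi i, ‖α k - α i‖) * ∏ k ∈ Finset.Iio i, ‖α i - α k‖ := fun i => by
      have hu : Finset.univ.erase i = Finset.Ioi i ∪ Finset.Iio i := by
        ext k; simp [eq_comm]
      rw [hu, Finset.prod_union]
      · congr 1
        exact Finset.prod_congr rfl fun k _ => norm_sub_rev _ _
      · exact Finset.disjoint_left.mpr fun k h1 h2 =>
          lt_asymm (Finset.mem_Ioi.mp h1) (Finset.mem_Iio.mp h2)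
    simp_rw [e]
    rw [Finset.prod_mul_distrib, sq]
    congr 1
    exact Finset.prod_comm' (by simp)
  rw [hres, norm_mul, norm_pow, norm_prod] at hone
  simp_rw [norm_prod] at hone
  rw [hV, ha, Complex.norm_intCast] at hone
  exact hone

/-- The left side is the Mahler measure, which is at most the sum of the absolute values of the
coefficients. -/
lemma leadingCoeff_mul_prod_max_le {p : ℤ[X]} {L : ℕ} (hL : ∀ i : ℕ, |p.coeff i| < 2 ^ L)
    {d : ℕ}
    (hd : p.natDegree = d) {α : Fin d → ℂ}
    (hr : (p.map (Int.castRingHom ℂ)).roots = Finset.univ.val.map α) :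
    |(p.leadingCoeff : ℝ)| * ∏ i, max 1 ‖α i‖ ≤ (d + 1) * 2 ^ L := by
  have h := mahlerMeasure_le_sum_norm_coeff (p.map (Int.castRingHom ℂ))
  rw [mahlerMeasure_eq_leadingCoeff_mul_prod_roots, hr, Multiset.map_map,
    leadingCoeff_map_of_injective (RingHom.injective_int _), eq_intCast, Complex.norm_intCast] at h
  refine h.trans ?_
  rw [sum_over_range _ (by simp), natDegree_map_eq_of_injective (RingHom.injective_int _), hd]
  refine (Finset.sum_le_card_nsmul _ _ (2 ^ L) fun i _ => ?_).trans (by simp)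
  rw [coeff_map, eq_intCast, Complex.norm_intCast]
  exact_mod_cast (hL i).le

lemma neg_sum_log_le_of_acyclic {p : ℤ[X]} {L d : ℕ} (hL : ∀ i : ℕ, |p.coeff i| < 2 ^ L)
    (hd : p.natDegree = d) (hd0 : d ≠ 0) {α : Fin d → ℂ}
    (hr : (p.map (Int.castRingHom ℂ)).roots = Finset.univ.val.map α)
    (hf : p.map (Int.castRingHom ℂ) = C (p.leadingCoeff : ℂ) * ∏ i, (X - C (α i)))
    (hα : Function.Injective α) (hL1 : 1 ≤ L) (I : Finset (Fin d)) (n : Fin d → Fin d)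
    (hn : (∀ i ∈ I, n i < i) ∨ (∀ i ∈ I, i < n i)) (hI : ∀ i ∈ I, ‖α i - α (n i)‖ ≤ 1 / d) :
    -∑ i ∈ I, Real.log ‖α i - α (n i)‖ ≤ 4 * d * (L + Real.log d) := by
  have hne : ∀ i ∈ I, α i ≠ α (n i) := fun i hi h => by
    have h' := hα h
    rcases hn with hn | hn
    · exact (hn i hi).ne h'.symm
    · exact (hn i hi).ne h'
  have hV := norm_det_vandermonde_le α I n hn hI hne
  have h1 := one_le_leadingCoeff_mul_det_vandermonde hd hd0 hr hf hα
  have hM := leadingCoeff_mul_prod_max_le hL hd hr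
  have hlc : p.leadingCoeff ≠ 0 := by
    rw [leadingCoeff_ne_zero]
    rintro rfl
    exact hd0 (hd.symm.trans natDegree_zero)
  set A : ℝ := |(p.leadingCoeff : ℝ)| with hA
  have hA1 : 1 ≤ A := by
    rw [hA]; exact_mod_cast Int.one_le_abs hlc
  have hAL : A ≤ 2 ^ L := by
    rw [hA]; exact_mod_cast (hL p.natDegree).le
  set Q : ℝ := ∏ i, max 1 ‖α i‖ with hQ
  have hQ1 : 1 ≤ Q := by
    rw [hQ]
    refine le_of_eq_of_le Finset.prod_const_one.symm
      (Finset.prod_le_prod (fun _ _ => zero_le_one) fun i _ => le_max_left _ _)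
  set P : ℝ := ∏ i ∈ I, ‖α i - α (n i)‖ with hP
  have hP0 : 0 < P := Finset.prod_pos fun i hi => norm_pos_iff.mpr (sub_ne_zero.mpr (hne i hi))
  set V : ℝ := ‖(Matrix.vandermonde α).det‖ with hVd
  have hd1 : (1 : ℝ) ≤ d := by exact_mod_cast Nat.one_le_iff_ne_zero.mpr hd0
  have hprod : ∏ i, (d * Real.exp 1 * max 1 ‖α i‖ ^ (d - 1)) =
      (d * Real.exp 1) ^ d * Q ^ (d - 1) := by
    rw [Finset.prod_mul_distrib, Finset.prod_const, Finset.prod_pow, Finset.card_univ,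
      Fintype.card_fin]
  rw [hprod] at hV
  -- Of the `2d - 1` powers of the leading coefficient, `2(d - 1)` are absorbed into the Mahler
  -- measure `A * Q`; a single `A` is left over.
  have hbound : A ^ (d - 1) * V ≤ P * (d.factorial * (d * Real.exp 1) ^ d) * (A * Q) ^ (d - 1) := by
    calc A ^ (d - 1) * V ≤ A ^ (d - 1) *
        (P * (d.factorial * ((d * Real.exp 1) ^ d * Q ^ (d - 1)))) := by gcongr
      _ = _ := by rw [mul_pow]; ring
  have hV0 : 0 ≤ V := norm_nonneg _
  have hfac : (0 : ℝ) < d.factorial := by exact_mod_cast d.factorial_pos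
  have hfin : 1 ≤ A * (P * (d.factorial * (d * Real.exp 1) ^ d) * (A * Q) ^ (d - 1)) ^ 2 := by
    calc 1 ≤ A ^ (2 * d - 1) * V ^ 2 := h1
      _ = A * (A ^ (d - 1) * V) ^ 2 := by
          rw [mul_pow, ← pow_mul, ← mul_assoc, ← pow_succ']
          congr 2
          omega
      _ ≤ _ := by gcongr
  have hlog := Real.log_nonneg hfin
  have hd0' : (0 : ℝ) < d := by linarith
  rw [Real.log_mul (by positivity) (by positivity), Real.log_pow,
    Real.log_mul (by positivity) (by positivity), Real.log_mul (by positivity) (by positivity),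
    Real.log_mul (by positivity) (by positivity), Real.log_pow, Real.log_pow,
    Real.log_mul (by positivity) (by positivity), Real.log_exp] at hlog
  have hlogP : Real.log P = ∑ i ∈ I, Real.log ‖α i - α (n i)‖ :=
    Real.log_prod fun i hi => norm_ne_zero_iff.mpr (sub_ne_zero.mpr (hne i hi))
  rw [← hlogP]
  have hlogA : Real.log A ≤ L := by
    calc Real.log A ≤ Real.log (2 ^ L) := Real.log_le_log (by linarith) hAL
      _ = L * Real.log 2 := Real.log_pow _ _
      _ ≤ L * 1 := by gcongr; exact Real.log_two_lt_d9.le.trans (by norm_num)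
      _ = L := mul_one _
  have hlogfac : Real.log d.factorial ≤ d * Real.log d := by
    rw [← Real.log_pow]
    exact Real.log_le_log hfac (by exact_mod_cast d.factorial_le_pow)
  have hlogM : Real.log (A * Q) ≤ Real.log d + 1 + L := by
    have h2 : (d : ℝ) + 1 ≤ d * Real.exp 1 := by
      have := Real.add_one_le_exp (1 : ℝ)
      nlinarith
    calc Real.log (A * Q) ≤ Real.log (d * Real.exp 1 * 2 ^ L) :=
          Real.log_le_log (by positivity) (hM.trans (by gcongr))
      _ = Real.log d + 1 + L * Real.log 2 := by
          rw [Real.log_mul (by positivity) (by positivity),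
            Real.log_mul (by positivity) (by positivity), Real.log_exp, Real.log_pow]
      _ ≤ Real.log d + 1 + L * 1 := by
          gcongr; exact Real.log_two_lt_d9.le.trans (by norm_num)
      _ = _ := by rw [mul_one]
  have hAQ1 : 1 ≤ A * Q := one_le_mul_of_one_le_of_one_le hA1 hQ1
  have hlogM' : ((d - 1 : ℕ) : ℝ) * Real.log (A * Q) ≤ d * (Real.log d + 1 + L) := by
    have h0 := Real.log_nonneg hAQ1
    have : ((d - 1 : ℕ) : ℝ) ≤ d := by exact_mod_cast Nat.sub_le d 1
    gcongr
  have hL1' : (1 : ℝ) ≤ L := by exact_mod_cast hL1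
  have hld : 0 ≤ Real.log d := Real.log_nonneg hd1
  push_cast at hlog
  have e1 : (d : ℝ) ≤ d * L := le_mul_of_one_le_right hd0'.le hL1'
  have e2 : (L : ℝ) ≤ d * L := le_mul_of_one_le_left (by linarith) hd1
  have e3 : 0 ≤ d * Real.log d := by positivity
  linarith

/-- Two roots may be each other's chosen neighbour, so the graph can have cycles. Splitting the
indices by `n i < i` or `i < n i` gives two acyclic parts costing `4 d (L + log d)` each; indices
with `s i = 1 / d` cost at most `d log d` in all. -/
lemma neg_sum_log_separation_le {p : ℤ[X]} {L d : ℕ} (hL : ∀ i : ℕ, |p.coeff i| < 2 ^ L)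
    (hd : p.natDegree = d) (hd0 : d ≠ 0) {α : Fin d → ℂ}
    (hr : (p.map (Int.castRingHom ℂ)).roots = Finset.univ.val.map α)
    (hf : p.map (Int.castRingHom ℂ) = C (p.leadingCoeff : ℂ) * ∏ i, (X - C (α i)))
    (hα : Function.Injective α) (hL1 : 1 ≤ L) {s : Fin d → ℝ} (hsd : ∀ i, s i ≤ 1 / d)
    (hs : ∀ i, s i = 1 / d ∨ ∃ n ≠ i, s i = ‖α i - α n‖) :
    -∑ i, Real.log (s i) ≤ 9 * d * (L + Real.log d) := by
  classical
  have hs' : ∀ i, ∃ n, s i ≠ 1 / d → n ≠ i ∧ s i = ‖α i - α n‖ := fun i => by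
    rcases hs i with h | ⟨n, h⟩
    · exact ⟨i, fun h' => absurd h h'⟩
    · exact ⟨n, fun _ => h⟩
  choose n hn using hs'
  have hd1 : (1 : ℝ) ≤ d := by exact_mod_cast Nat.one_le_iff_ne_zero.mpr hd0
  have hld : 0 ≤ Real.log d := Real.log_nonneg hd1
  have key : ∀ (q : Fin d → Fin d → Prop) [∀ i j, Decidable (q i j)], (∀ i j, q i j → s i ≠ 1 / d) →
      ((∀ i j, q i j → j < i) ∨ (∀ i j, q i j → i < j)) →
      -∑ i, (if q i (n i) then Real.log (s i) else 0) ≤ 4 * d * (L + Real.log d) := by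
    intro q _ hq1 hq2
    have h := neg_sum_log_le_of_acyclic hL hd hd0 hr hf hα hL1
      (Finset.univ.filter fun i => q i (n i)) n
      (hq2.imp (fun h i hi => h i _ (Finset.mem_filter.mp hi).2)
        (fun h i hi => h i _ (Finset.mem_filter.mp hi).2))
      (fun i hi => by
        rw [← (hn i (hq1 i _ (Finset.mem_filter.mp hi).2)).2]; exact hsd i)
    rw [← Finset.sum_filter]
    refine le_of_eq_of_le ?_ h
    congr 1
    refine Finset.sum_congr rfl fun i hi => ?_
    rw [← (hn i (hq1 i _ (Finset.mem_filter.mp hi).2)).2]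
  have k1 := key (fun i j => s i ≠ 1 / d ∧ j < i) (fun i j h => h.1) (Or.inl fun i j h => h.2)
  have k2 := key (fun i j => s i ≠ 1 / d ∧ i < j) (fun i j h => h.1) (Or.inr fun i j h => h.2)
  have hpt : ∀ i ∈ Finset.univ, (if s i ≠ 1 / d ∧ n i < i then Real.log (s i) else 0) +
      (if s i ≠ 1 / d ∧ i < n i then Real.log (s i) else 0) + -Real.log d ≤ Real.log (s i) := by
    intro i _
    by_cases h : s i = 1 / d
    · simp [h]
    · rcases lt_or_gt_of_ne (hn i h).1 with h' | h'
      · simp only [ne_eq, h, not_false_eq_true, h', and_self, if_true, h'.not_gt, and_false, if_false]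
        linarith
      · simp only [ne_eq, h, not_false_eq_true, h', and_self, if_true, h'.not_gt, and_false, if_false]
        linarith
  have hsum := Finset.sum_le_sum hpt
  rw [Finset.sum_add_distrib, Finset.sum_add_distrib, Finset.sum_const, Finset.card_univ,
    Fintype.card_fin, nsmul_eq_mul] at hsum
  have hdL : 0 ≤ (d : ℝ) * L := by positivity
  linarith

/-! ### Integral of the truncated inverse square distance -/

open MeasureTheory

/-- For `t < D` one term is enough: the first dyadic radius `2 ^ k * ρ` beyond `t` is at most `2 *
max t ρ`. -/
lemma inv_sq_max_le_sum {t ρ D : ℝ} (hρ : 0 < ρ) (hD : 0 < D) {K : ℕ} (hK : D ≤ 2 ^ K * ρ) :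
    ((max t ρ) ^ 2)⁻¹ ≤ (D ^ 2)⁻¹ +
      ∑ k ∈ Finset.range (K + 1), if t < 2 ^ k * ρ then 4 * ((2 ^ k * ρ) ^ 2)⁻¹ else 0 := by
  classical
  have hnn : ∀ k ∈ Finset.range (K + 1),
      0 ≤ if t < 2 ^ k * ρ then 4 * ((2 ^ k * ρ) ^ 2)⁻¹ else 0 := fun k _ => by
    split_ifs <;> positivity
  by_cases htD : D ≤ t
  · have h1 : ((max t ρ) ^ 2)⁻¹ ≤ (D ^ 2)⁻¹ := by
      gcongr
      exact htD.trans (le_max_left _ _)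
    linarith [Finset.sum_nonneg hnn]
  · have hex : ∃ k, t < 2 ^ k * ρ := ⟨K, (not_le.mp htD).trans_le hK⟩
    have hkK : Nat.find hex ≤ K := Nat.find_min' hex ((not_le.mp htD).trans_le hK)
    have hspec := Nat.find_spec hex
    have h1 : ((max t ρ) ^ 2)⁻¹ ≤ 4 * ((2 ^ Nat.find hex * ρ) ^ 2)⁻¹ := by
      have h2 : 2 ^ Nat.find hex * ρ ≤ 2 * max t ρ := by
        rcases Nat.eq_zero_or_pos (Nat.find hex) with h0 | h0
        · rw [h0]
          have := le_max_right t ρ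
          linarith
        · have h3 : ¬ t < 2 ^ (Nat.find hex - 1) * ρ := Nat.find_min hex (by omega)
          have h4 : (2 : ℝ) ^ Nat.find hex = 2 * 2 ^ (Nat.find hex - 1) := by
            rw [← pow_succ']
            congr 1
            omega
          rw [h4, mul_assoc]
          have := le_max_left t ρ
          linarith
      have h5 : (0 : ℝ) < max t ρ := hρ.trans_le (le_max_right _ _)
      calc ((max t ρ) ^ 2)⁻¹ = 4 * ((2 * max t ρ) ^ 2)⁻¹ := by
            field_simp
            norm_num
        _ ≤ _ := by gcongr
    have h6 := Finset.single_le_sum hnn (Finset.mem_range.mpr (Nat.lt_succ_of_le hkK))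
    rw [if_pos hspec] at h6
    have : 0 ≤ (D ^ 2)⁻¹ := by positivity
    linarith

lemma continuous_inv_sq_max (a : ℂ) {ρ : ℝ} (hρ : 0 < ρ) :
    Continuous fun z : ℂ => ((max ‖z - a‖ ρ) ^ 2)⁻¹ := by
  refine Continuous.inv₀ (by fun_prop) fun z => ?_
  have : 0 < max ‖z - a‖ ρ := hρ.trans_le (le_max_right _ _)
  positivity

/-- A ball of radius `r` weighted by `4 / r²` has mass `4π` at every scale, so the cost is linear in
the number of scales. -/
lemma integral_inv_sq_max_le (a : ℂ) {ρ D : ℝ} (hρ : 0 < ρ) (hD : 0 < D) {K : ℕ}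
    (hK : D ≤ 2 ^ K * ρ) {R : Set ℂ} (hR : volume R ≠ ⊤)
    (hint : IntegrableOn (fun z : ℂ => ((max ‖z - a‖ ρ) ^ 2)⁻¹) R) :
    ∫ z in R, ((max ‖z - a‖ ρ) ^ 2)⁻¹ ≤
      volume.real R * (D ^ 2)⁻¹ + (K + 1) * (4 * Real.pi) := by
  have hball : ∀ k : ℕ, (fun z : ℂ => if ‖z - a‖ < 2 ^ k * ρ then 4 * ((2 ^ k * ρ) ^ 2)⁻¹ else 0) =
      (Metric.ball a (2 ^ k * ρ)).indicator fun _ => 4 * ((2 ^ k * ρ) ^ 2)⁻¹ := fun k => by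
    ext z
    simp only [Set.indicator, Metric.mem_ball, dist_eq_norm]
  have hik : ∀ k : ℕ, Integrable (fun z : ℂ => if ‖z - a‖ < 2 ^ k * ρ then
      4 * ((2 ^ k * ρ) ^ 2)⁻¹ else 0) := fun k => by
    rw [hball, integrable_indicator_iff measurableSet_ball]
    exact integrableOn_const measure_ball_lt_top.ne
  have hval : ∀ k : ℕ, ∫ z in R, (if ‖z - a‖ < 2 ^ k * ρ then 4 * ((2 ^ k * ρ) ^ 2)⁻¹ else 0) ≤
      4 * Real.pi := fun k => by
    refine (setIntegral_le_integral (hik k) (.of_forall fun z => ?_)).trans ?_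
    · dsimp only
      split_ifs
      · simp only [Pi.zero_apply]; positivity
      · exact le_rfl
    · rw [hball, integral_indicator_const _ measurableSet_ball, smul_eq_mul, measureReal_def,
        Complex.volume_ball]
      simp only [ENNReal.toReal_mul, ENNReal.toReal_pow, ENNReal.coe_toReal, NNReal.coe_real_pi]
      rw [ENNReal.toReal_ofReal (by positivity)]
      refine le_of_eq ?_
      field_simp
  have hc : IntegrableOn (fun _ : ℂ => (D ^ 2)⁻¹) R := integrableOn_const hR
  calc ∫ z in R, ((max ‖z - a‖ ρ) ^ 2)⁻¹
      ≤ ∫ z in R, ((D ^ 2)⁻¹ + ∑ k ∈ Finset.range (K + 1),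
          if ‖z - a‖ < 2 ^ k * ρ then 4 * ((2 ^ k * ρ) ^ 2)⁻¹ else 0) := by
        refine integral_mono hint (hc.add (integrable_finsetSum _ fun k _ => (hik k).integrableOn))
          fun z => inv_sq_max_le_sum hρ hD hK
    _ = volume.real R * (D ^ 2)⁻¹ + ∑ k ∈ Finset.range (K + 1),
          ∫ z in R, (if ‖z - a‖ < 2 ^ k * ρ then 4 * ((2 ^ k * ρ) ^ 2)⁻¹ else 0) := by
        rw [integral_add hc (integrable_finsetSum _ fun k _ => (hik k).integrableOn),
          integral_finsetSum _ fun k _ => (hik k).integrableOn, setIntegral_const, smul_eq_mul]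
    _ ≤ _ := by
        gcongr
        refine (Finset.sum_le_card_nsmul _ _ _ fun k _ => hval k).trans ?_
        rw [Finset.card_range, nsmul_eq_mul]
        push_cast
        exact le_rfl

/-! ### Half-open cells and their tilings -/

open Set

/-- The half-open square `[re, re + width) × [im, im + width)i`. -/
def Square.cell (S : Square) : Set ℂ :=
  Ico S.re (S.re + S.width) ×ℂ Ico S.im (S.im + S.width)

lemma measurableSet_reProdIm_Ico (a b c d : ℝ) : MeasurableSet (Ico a b ×ℂ Ico c d) :=
  (measurableSet_Ico.preimage Complex.measurable_re).inter
    (measurableSet_Ico.preimage Complex.measurable_im)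

lemma volume_reProdIm_Ico (a b c d : ℝ) :
    volume (Ico a b ×ℂ Ico c d) = ENNReal.ofReal (b - a) * ENNReal.ofReal (d - c) := by
  have h : Ico a b ×ℂ Ico c d = Complex.measurableEquivRealProd ⁻¹' (Ico a b ×ˢ Ico c d) := by
    ext z; simp [Complex.mem_reProdIm]
  rw [h, Complex.volume_preserving_equiv_real_prod.measure_preimage_equiv, Measure.volume_eq_prod,
    Measure.prod_prod, Real.volume_Ico, Real.volume_Ico]

lemma volume_cell_ne_top (S : Square) : volume S.cell ≠ ⊤ := by
  rw [Square.cell, volume_reProdIm_Ico]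
  exact ENNReal.mul_ne_top ENNReal.ofReal_ne_top ENNReal.ofReal_ne_top

lemma volume_real_cell {S : Square} (hS : 0 ≤ S.width) : volume.real S.cell = S.width ^ 2 := by
  rw [measureReal_def, Square.cell, volume_reProdIm_Ico]
  simp [hS, sq]

lemma integrableOn_reProdIm_Ico {F : ℂ → ℝ} (hF : Continuous F) (a b c d : ℝ) :
    IntegrableOn F (Ico a b ×ℂ Ico c d) :=
  (hF.continuousOn.integrableOn_compact (isCompact_Icc.reProdIm isCompact_Icc)).mono_set
    (inter_subset_inter (preimage_mono Ico_subset_Icc_self) (preimage_mono Ico_subset_Icc_self))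

lemma setIntegral_cell_eq_add {F : ℂ → ℝ} (hF : Continuous F) {S : Square} (hS : 0 < S.width) :
    ∫ z in S.cell, F z =
      (∫ z in (⟨S.re, S.im, S.width / 2⟩ : Square).cell, F z) +
      (∫ z in (⟨S.re + S.width / 2, S.im, S.width / 2⟩ : Square).cell, F z) +
      (∫ z in (⟨S.re, S.im + S.width / 2, S.width / 2⟩ : Square).cell, F z) +
      (∫ z in (⟨S.re + S.width / 2, S.im + S.width / 2, S.width / 2⟩ : Square).cell, F z) := by
  have hre : ∀ {a b c : ℝ} (d e : ℝ), a ≤ b → b ≤ c → ∫ z in Ico a c ×ℂ Ico d e, F z =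
      (∫ z in Ico a b ×ℂ Ico d e, F z) + ∫ z in Ico b c ×ℂ Ico d e, F z := by
    intro a b c d e hab hbc
    rw [← setIntegral_union _ (measurableSet_reProdIm_Ico _ _ _ _)
      (integrableOn_reProdIm_Ico hF _ _ _ _) (integrableOn_reProdIm_Ico hF _ _ _ _),
      ← Ico_union_Ico_eq_Ico hab hbc]
    · congr 2
      ext z
      simp only [Complex.mem_reProdIm, mem_union]
      tauto
    · rw [Set.disjoint_left]
      intro z hz hz'
      exact (hz.1.2.trans_le hz'.1.1).false
  have him : ∀ {a b c : ℝ} (d e : ℝ), a ≤ b → b ≤ c → ∫ z in Ico d e ×ℂ Ico a c, F z =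
      (∫ z in Ico d e ×ℂ Ico a b, F z) + ∫ z in Ico d e ×ℂ Ico b c, F z := by
    intro a b c d e hab hbc
    rw [← setIntegral_union _ (measurableSet_reProdIm_Ico _ _ _ _)
      (integrableOn_reProdIm_Ico hF _ _ _ _) (integrableOn_reProdIm_Ico hF _ _ _ _),
      ← Ico_union_Ico_eq_Ico hab hbc]
    · congr 2
      ext z
      simp only [Complex.mem_reProdIm, mem_union]
      tauto
    · rw [Set.disjoint_left]
      intro z hz hz'
      exact (hz.2.2.trans_le hz'.2.1).false
  simp only [Square.cell]
  rw [him (b := S.im + S.width / 2) _ _ (by linarith) (by linarith),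
    hre (b := S.re + S.width / 2) S.im (S.im + S.width / 2) (by linarith) (by linarith),
    hre (b := S.re + S.width / 2) (S.im + S.width / 2) (S.im + S.width) (by linarith)
      (by linarith)]
  simp only [add_assoc, add_halves]

lemma cell_subset_of_mem_children {S T : Square} (hS : 0 < S.width) (hT : T ∈ S.children) :
    T.cell ⊆ S.cell := by
  intro z hz
  simp only [Square.children, mem_insert_iff, mem_singleton_iff] at hT
  simp only [Square.cell, Complex.mem_reProdIm, mem_Ico] at hz ⊢
  rcases hT with rfl | rfl | rfl | rfl <;> simp only at hz <;>
    refine ⟨⟨?_, ?_⟩, ?_, ?_⟩ <;> linarith [hz.1.1, hz.1.2, hz.2.1, hz.2.2]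

lemma width_of_mem_children {S T : Square} (hT : T ∈ S.children) : T.width = S.width / 2 := by
  simp only [Square.children, mem_insert_iff, mem_singleton_iff] at hT
  rcases hT with rfl | rfl | rfl | rfl <;> rfl

/-! ### The subdivision tree and continuous amortization -/

lemma IsNode.eq_or_exists {B : Square → Prop} {R S : Square} (h : IsNode B R S) :
    S = R ∨ ¬ B R ∧ ∃ T ∈ R.children, IsNode B T S := by
  -- `IsNode` extends paths at the leaf end; this induction detaches the first step at the root
  -- instead.
  induction h with
  | root => exact Or.inl rfl
  | child hS hB hT ih =>
    rcases ih with rfl | ⟨hR, U, hU, hn⟩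
    · exact Or.inr ⟨hB, _, hT, .root⟩
    · exact Or.inr ⟨hR, U, hU, .child hn hB hT⟩

lemma subdivisionTree_of_terminal {B : Square → Prop} {R : Square} (h : B R) :
    subdivisionTree B R = {R} := by
  ext S
  refine ⟨fun hS => ?_, ?_⟩
  · exact (IsNode.eq_or_exists hS).resolve_right fun h' => h'.1 h
  · rintro rfl; exact .root

lemma subdivisionTree_subset (B : Square → Prop) (R : Square) :
    subdivisionTree B R ⊆ insert R (⋃ T ∈ R.children, subdivisionTree B T) := by
  intro S hS
  rcases IsNode.eq_or_exists hS with rfl | ⟨-, T, hT, h⟩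
  · exact mem_insert _ _
  · exact mem_insert_of_mem _ (mem_biUnion hT h)

/-- Continuous amortization: a function that is at least `4 / w²` on each nonterminal square of
width `w` bounds the size of the subdivision tree by its integral. -/
lemma subdivisionTree_amortization {B : Square → Prop} {F : ℂ → ℝ} (hF : Continuous F)
    {M : ℝ} (hM : ∀ z, F z ≤ M)
    (hB : ∀ S : Square, 0 < S.width → ¬ B S → ∀ z ∈ S.cell, ((S.width / 2) ^ 2)⁻¹ ≤ F z)
    {R : Square} (hR : 0 < R.width) :
    (subdivisionTree B R).Finite ∧
      (1 ≤ ∫ z in R.cell, F z →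
        ((subdivisionTree B R).ncard : ℝ) ≤ 2 * (∫ z in R.cell, F z) - 1) := by
  -- Induction on an exponent that drops by one per bisection, since `width²` drops by a factor 4.
  -- At `n = 0` the bound `M` forces the square to be terminal.
  have main : ∀ n : ℕ, ∀ S : Square, 0 < S.width → M * (S.width / 2) ^ 2 < 4 ^ n →
      (subdivisionTree B S).Finite ∧ (1 ≤ ∫ z in S.cell, F z →
        ((subdivisionTree B S).ncard : ℝ) ≤ 2 * (∫ z in S.cell, F z) - 1) := by
    intro n
    induction n with
    | zero =>
      intro S hS hw
      by_cases hBS : B S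
      · rw [subdivisionTree_of_terminal hBS]
        refine ⟨finite_singleton _, fun h => ?_⟩
        rw [ncard_singleton]; push_cast; linarith
      · exfalso
        have h1 := hB S hS hBS ⟨S.re, S.im⟩ (by simp [Square.cell, Complex.mem_reProdIm, hS])
        have h2 := h1.trans (hM _)
        rw [inv_le_iff_one_le_mul₀ (by positivity)] at h2
        linarith
    | succ n ih =>
      intro S hS hw
      by_cases hBS : B S
      · rw [subdivisionTree_of_terminal hBS]
        refine ⟨finite_singleton _, fun h => ?_⟩
        rw [ncard_singleton]; push_cast; linarith
      · have hch : ∀ T ∈ S.children, (subdivisionTree B T).Finite ∧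
            ((subdivisionTree B T).ncard : ℝ) ≤ 2 * (∫ z in T.cell, F z) - 1 := by
          intro T hT
          have hTw := width_of_mem_children hT
          have hT0 : 0 < T.width := by rw [hTw]; linarith
          have h1 := ih T hT0 (by rw [hTw]; rw [pow_succ (4 : ℝ)] at hw; linarith)
          refine ⟨h1.1, h1.2 ?_⟩
          -- The lower bound for `F` comes from the nonterminal parent, and the child has area
          -- `(S.width / 2) ^ 2`. Hence its integral is at least 1, whether or not the child is
          -- terminal.
          have h2 : ((S.width / 2) ^ 2)⁻¹ * volume.real T.cell ≤ ∫ z in T.cell, F z :=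
            setIntegral_ge_of_const_le_real (measurableSet_reProdIm_Ico _ _ _ _)
            (volume_cell_ne_top T)
            (fun z hz => hB S hS hBS z (cell_subset_of_mem_children hS hT hz))
            (integrableOn_reProdIm_Ico hF _ _ _ _)
          rw [volume_real_cell hT0.le, hTw, inv_mul_cancel₀ (by positivity)] at h2
          exact h2
        have hfinU : (⋃ T ∈ S.children, subdivisionTree B T).Finite := by
          refine Finite.biUnion ?_ fun T hT => (hch T hT).1
          exact (((finite_singleton _).insert _).insert _).insert _
        refine ⟨(hfinU.insert S).subset (subdivisionTree_subset B S), fun _ => ?_⟩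
        have hcard : (subdivisionTree B S).ncard ≤
            (subdivisionTree B ⟨S.re, S.im, S.width / 2⟩).ncard +
            ((subdivisionTree B ⟨S.re + S.width / 2, S.im, S.width / 2⟩).ncard +
            ((subdivisionTree B ⟨S.re, S.im + S.width / 2, S.width / 2⟩).ncard +
            (subdivisionTree B ⟨S.re + S.width / 2, S.im + S.width / 2, S.width / 2⟩).ncard))
              + 1 := by
          refine (ncard_le_ncard (subdivisionTree_subset B S) (hfinU.insert S)).trans ?_
          refine (ncard_insert_le _ _).trans (Nat.add_le_add_right ?_ 1)
          simp only [Square.children, biUnion_insert, biUnion_singleton]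
          refine (ncard_union_le _ _).trans (Nat.add_le_add_left ?_ _)
          refine (ncard_union_le _ _).trans (Nat.add_le_add_left ?_ _)
          exact ncard_union_le _ _
        have hcard' : ((subdivisionTree B S).ncard : ℝ) ≤ _ := Nat.cast_le.mpr hcard
        push_cast at hcard'
        rw [setIntegral_cell_eq_add hF hS]
        have c1 := (hch ⟨S.re, S.im, S.width / 2⟩ (by simp [Square.children])).2
        have c2 := (hch ⟨S.re + S.width / 2, S.im, S.width / 2⟩ (by simp [Square.children])).2
        have c3 := (hch ⟨S.re, S.im + S.width / 2, S.width / 2⟩ (by simp [Square.children])).2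
        have c4 := (hch ⟨S.re + S.width / 2, S.im + S.width / 2, S.width / 2⟩
          (by simp [Square.children])).2
        -- The node itself adds 1 and the four children subtract 4, leaving `2 ∫ F - 3`.
        linarith
  obtain ⟨n, hn⟩ := pow_unbounded_of_one_lt (M * (R.width / 2) ^ 2) (by norm_num : (1 : ℝ) < 4)
  exact main n R hR hn

/-! ### Geometric conditions that make a square terminal -/

lemma norm_sub_mid_le {S : Square} {z : ℂ} (hz : z ∈ S.cell) :
    ‖z - S.mid‖ ≤ S.width := by
  simp only [Square.cell, Complex.mem_reProdIm, mem_Ico] at hz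
  refine (Complex.norm_le_abs_re_add_abs_im _).trans ?_
  simp only [Square.mid, Complex.sub_re, Complex.sub_im]
  have h1 : |z.re - (S.re + S.width / 2)| ≤ S.width / 2 := by
    rw [abs_le]; constructor <;> linarith [hz.1.1, hz.1.2]
  have h2 : |z.im - (S.im + S.width / 2)| ≤ S.width / 2 := by
    rw [abs_le]; constructor <;> linarith [hz.2.1, hz.2.2]
  linarith

lemma diam_le {S : Square} (hS : 0 < S.width) : S.diam ≤ 3 / 2 * S.width := by
  rw [Square.diam]
  gcongr
  rw [Real.sqrt_le_left (by norm_num)]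
  norm_num

lemma diam_nonneg {S : Square} (hS : 0 < S.width) : 0 ≤ S.diam :=
  mul_nonneg (Real.sqrt_nonneg _) hS.le

/-- Far from the roots, compared to its width, a square passes the exclusion test. -/
lemma taylorTest_of_far {f : ℂ[X]} {a : ℂ} (ha : a ≠ 0) {d : ℕ} {α : Fin d → ℂ}
    (hf : f = C a * ∏ i, (X - C (α i))) {S : Square} (hS : 0 < S.width) {z : ℂ}
    (hz : z ∈ S.cell) (hne : ∀ i, z ≠ α i)
    (h : S.width ^ 2 * (d * ∑ i, (‖z - α i‖ ^ 2)⁻¹) < 1 / 16) :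
    taylorTest f S.mid (S.diam / 2) 1 := by
  have hpos : ∀ i, 0 < ‖z - α i‖ := fun i => norm_pos_iff.mpr (sub_ne_zero.mpr (hne i))
  -- Cauchy–Schwarz, at the cost of a factor `d`.
  have hcs : (S.width * ∑ i, ‖z - α i‖⁻¹) ^ 2 < (1 / 4) ^ 2 := by
    have h1 := sq_sum_le_card_mul_sum_sq (s := Finset.univ) (f := fun i => ‖z - α i‖⁻¹)
    rw [Finset.card_univ, Fintype.card_fin] at h1
    simp_rw [inv_pow] at h1
    calc (S.width * ∑ i, ‖z - α i‖⁻¹) ^ 2 ≤ S.width ^ 2 * (d * ∑ i, (‖z - α i‖ ^ 2)⁻¹) := by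
          rw [mul_pow]; gcongr
      _ < _ := by linarith
  have hsum0 : 0 ≤ ∑ i, ‖z - α i‖⁻¹ := Finset.sum_nonneg fun i _ => by positivity
  have hlt : S.width * ∑ i, ‖z - α i‖⁻¹ < 1 / 4 := lt_of_pow_lt_pow_left₀ 2 (by norm_num) hcs
  -- A single inverse distance is at most the sum, so the width is below a quarter of each distance,
  -- and passing from `z` to the midpoint changes distances little.
  have hfar : ∀ i, 3 / 4 * ‖z - α i‖ ≤ ‖S.mid - α i‖ := fun i => by
    have h1 : ‖z - α i‖⁻¹ ≤ ∑ i, ‖z - α i‖⁻¹ :=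
      Finset.single_le_sum (f := fun i => ‖z - α i‖⁻¹) (fun j _ => by positivity)
        (Finset.mem_univ i)
    have h2 : S.width * ‖z - α i‖⁻¹ < 1 / 4 := (by gcongr : _ ≤ _).trans_lt hlt
    rw [← div_eq_mul_inv, div_lt_iff₀ (hpos i)] at h2
    have h3 := norm_sub_mid_le hz
    have h4 : ‖z - α i‖ ≤ ‖z - S.mid‖ + ‖S.mid - α i‖ := norm_sub_le_norm_sub_add_norm_sub _ _ _
    linarith
  have hsum : ∑ i, ‖S.mid - α i‖⁻¹ ≤ 4 / 3 * ∑ i, ‖z - α i‖⁻¹ := by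
    rw [Finset.mul_sum]
    refine Finset.sum_le_sum fun i _ => ?_
    calc ‖S.mid - α i‖⁻¹ ≤ (3 / 4 * ‖z - α i‖)⁻¹ :=
          inv_anti₀ (by have := hpos i; positivity) (hfar i)
      _ = _ := by rw [mul_inv]; norm_num
  refine taylorTest_of_sum_lt ha hf (fun i hi => ?_) (by have := diam_nonneg hS; linarith) ?_
  · have := hfar i
    rw [hi, sub_self, norm_zero] at this
    linarith [hpos i]
  · have hd := diam_le hS
    have h1 : S.diam / 2 * ∑ i, ‖S.mid - α i‖⁻¹ ≤ 1 / 4 := by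
      calc S.diam / 2 * ∑ i, ‖S.mid - α i‖⁻¹ ≤
            (3 / 4 * S.width) * (4 / 3 * ∑ i, ‖z - α i‖⁻¹) := by
            refine mul_le_mul (by linarith) hsum (Finset.sum_nonneg fun i _ => by positivity)
              (by linarith)
        _ = S.width * ∑ i, ‖z - α i‖⁻¹ := by ring
        _ ≤ _ := hlt.le
    calc Real.exp (S.diam / 2 * ∑ i, ‖S.mid - α i‖⁻¹) ≤ Real.exp (1 / 4) := Real.exp_le_exp.mpr h1
      _ < 1 + 1 := by
        have := Real.exp_bound_div_one_sub_of_interval' (x := 1 / 4) (by norm_num) (by norm_num)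
        linarith

/-- Close to a root of `p`, compared to its separation, a square passes the tests for `p'`. -/
lemma taylorTest_derivative_of_near {f : ℂ[X]} {a : ℂ} (ha : a ≠ 0) {d : ℕ} {α : Fin d → ℂ}
    (hf : f = C a * ∏ i, (X - C (α i))) (hfd : f.natDegree = d) {i : Fin d} {s ρ : ℝ} (hs : 0 < s)
    (hsi : ∀ k ≠ i, s ≤ ‖α i - α k‖) (hρ : ρ = s / (30 * d ^ 2)) {S : Square} (hS : 0 < S.width)
    (hw : S.width ≤ ρ / 4) {z : ℂ} (hz : z ∈ S.cell) (hzi : ‖z - α i‖ ≤ ρ) :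
    taylorTest (derivative f) S.mid (2 * S.diam) (1 / 6) ∧
      taylorTest (derivative f) S.mid (4 * S.diam) (1 / √2) := by
  have hd : 0 < d := i.pos
  have hd' : (1 : ℝ) ≤ d := by exact_mod_cast hd
  have hf0 : derivative f ≠ 0 := by
    intro h
    have := derivative_eq_zero.mp h
    omega
  obtain ⟨β, hβr, hβ⟩ := exists_fin_roots (derivative f)
  have hdeg : (derivative f).natDegree ≤ d := (natDegree_derivative_le f).trans (by omega)
  have hcrit : ∀ j, s / d ≤ ‖β j - α i‖ := fun j => by
    refine dist_critical_point ha hf hs hsi ?_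
    have : β j ∈ (derivative f).roots := by
      rw [hβr]; exact Multiset.mem_map_of_mem _ (Finset.mem_univ_val j)
    exact (mem_roots hf0).mp this
  have hsd : 0 < s / d := by positivity
  have hρ0 : 0 < ρ := by rw [hρ]; positivity
  have hρd : ρ * (30 * d) = s / d := by rw [hρ]; field_simp
  have hρs : 30 * ρ ≤ s / d := by
    rw [← hρd]; nlinarith
  have hfar : ∀ j, s / (2 * d) ≤ ‖S.mid - β j‖ := fun j => by
    have h1 := hcrit j
    have h2 := norm_sub_mid_le hz
    have h3 : ‖β j - α i‖ ≤ ‖β j - S.mid‖ + ‖S.mid - α i‖ := norm_sub_le_norm_sub_add_norm_sub _ _ _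
    have h4 : ‖S.mid - α i‖ ≤ ‖S.mid - z‖ + ‖z - α i‖ := norm_sub_le_norm_sub_add_norm_sub _ _ _
    rw [norm_sub_rev S.mid z] at h4
    rw [norm_sub_rev (β j) S.mid] at h3
    -- The midpoint is within `5ρ/4` of `α i`, well below half of `s / d ≥ 30ρ`.
    have h5 : s / (2 * d) = s / d / 2 := by field_simp
    linarith
  have hsum : ∑ j, ‖S.mid - β j‖⁻¹ ≤ d * (2 * d / s) := by
    calc ∑ j, ‖S.mid - β j‖⁻¹ ≤ ∑ _j : Fin (derivative f).natDegree, (2 * d / s : ℝ) := by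
          refine Finset.sum_le_sum fun j _ => ?_
          rw [← inv_div]
          exact inv_anti₀ (by positivity) (hfar j)
      _ = (derivative f).natDegree * (2 * d / s : ℝ) := by simp
      _ ≤ _ := by gcongr
  have hdiam := diam_le hS
  have hdiam0 := diam_nonneg hS
  have h0 : 0 ≤ ∑ j, ‖S.mid - β j‖⁻¹ := Finset.sum_nonneg fun i _ => by positivity
  -- Here `4 diam ≤ 6 w ≤ 3ρ/2`; the 30 in `ρ` makes the product `1/10`, and `exp (1/10) ≤ 10/9 <
  -- 7/6`.
  have h4 : 4 * S.diam * ∑ j, ‖S.mid - β j‖⁻¹ ≤ 1 / 10 := by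
    calc 4 * S.diam * ∑ j, ‖S.mid - β j‖⁻¹ ≤ (3 / 2 * ρ) * (d * (2 * d / s)) := by
          exact mul_le_mul (by linarith) hsum h0 (by linarith)
      _ = 1 / 10 := by rw [hρ]; field_simp; norm_num
  have h2 : 2 * S.diam * ∑ j, ‖S.mid - β j‖⁻¹ ≤ 1 / 10 := by nlinarith
  have hexp : Real.exp (1 / 10) < 1 + 1 / 6 := by
    have := Real.exp_bound_div_one_sub_of_interval' (x := 1 / 10) (by norm_num) (by norm_num)
    linarith
  have hne : ∀ j, S.mid ≠ β j := fun j hj => by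
    have := hfar j
    rw [hj, sub_self, norm_zero] at this
    have : 0 < s / (2 * d) := by positivity
    linarith
  have hsqrt : (1 : ℝ) / 6 ≤ 1 / √2 := by
    gcongr
    rw [Real.sqrt_le_left (by norm_num)]
    norm_num
  have hlc := leadingCoeff_ne_zero.mpr hf0
  refine ⟨taylorTest_of_sum_lt hlc hβ hne (by positivity) ?_,
    taylorTest_of_sum_lt hlc hβ hne (by positivity) ?_⟩
  · exact (Real.exp_le_exp.mpr h2).trans_lt hexp
  · exact ((Real.exp_le_exp.mpr h4).trans_lt hexp).trans_le (by linarith)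

/-! ### Choice of the separations and of the number of scales -/

lemma exists_separation {d : ℕ} {α : Fin d → ℂ} (hα : Function.Injective α) (i : Fin d) :
    ∃ s : ℝ, 0 < s ∧ s ≤ 1 / d ∧ (s = 1 / d ∨ ∃ n ≠ i, s = ‖α i - α n‖) ∧
      ∀ k ≠ i, s ≤ ‖α i - α k‖ := by
  classical
  have hd : (0 : ℝ) < d := by exact_mod_cast i.pos
  -- The cap `1 / d` keeps chosen pairs close enough for `norm_pow_sub_pow_le` and covers `d = 1`,
  -- where there is no other root.
  let T : Finset ℝ := insert (1 / (d : ℝ)) ((Finset.univ.erase i).image fun k => ‖α i - α k‖)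
  have hT : T.Nonempty := Finset.insert_nonempty _ _
  have hmem : T.min' hT = 1 / d ∨ ∃ n ≠ i, T.min' hT = ‖α i - α n‖ := by
    rcases Finset.mem_insert.mp (T.min'_mem hT) with h | h
    · exact Or.inl h
    · obtain ⟨n, hn, h⟩ := Finset.mem_image.mp h
      exact Or.inr ⟨n, Finset.ne_of_mem_erase hn, h.symm⟩
  refine ⟨T.min' hT, ?_, T.min'_le _ (Finset.mem_insert_self _ _), hmem, fun k hk => ?_⟩
  · rcases hmem with h | ⟨n, hn, h⟩
    · rw [h]; positivity
    · rw [h]; exact norm_pos_iff.mpr (sub_ne_zero.mpr fun h' => hn (hα h').symm)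
  · exact T.min'_le _ (Finset.mem_insert_of_mem (Finset.mem_image_of_mem _
      (Finset.mem_erase.mpr ⟨hk, Finset.mem_univ k⟩)))

lemma exists_dyadic_scale (L : ℕ) {ρ : ℝ} (hρ : 0 < ρ) (hρ1 : ρ ≤ 1) :
    ∃ K : ℕ, (2 : ℝ) ^ L ≤ 2 ^ K * ρ ∧ (K : ℝ) ≤ L + 1 - 2 * Real.log ρ := by
  have hlog : Real.log ρ ≤ 0 := Real.log_nonpos hρ.le hρ1
  -- The factor 2 works because `2 log 2 > 1`.
  refine ⟨L + ⌈-2 * Real.log ρ⌉₊, ?_, ?_⟩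
  · rw [pow_add, mul_assoc]
    refine le_mul_of_one_le_right (by positivity) ?_
    rw [← Real.log_nonneg_iff (by positivity), Real.log_mul (by positivity) hρ.ne', Real.log_pow]
    have h1 := Nat.le_ceil (-2 * Real.log ρ)
    have h2 := Real.log_two_gt_d9
    nlinarith
  · have := Nat.ceil_lt_add_one (a := -2 * Real.log ρ) (by linarith)
    push_cast
    linarith

end CEval

/-! ### Assembly of the node bound -/

theorem mainTheorem6 :
    ∃ C : ℝ, ∀ (L : ℕ) (p : ℤ[X]),
      (∀ i : ℕ, |p.coeff i| < 2 ^ L) →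
      Squarefree (p.map (Int.castRingHom ℂ)) →
      Squarefree (derivative (p.map (Int.castRingHom ℂ))) →
      (CEval.subdivisionTree (CEval.sqFreeCEVAL (p.map (Int.castRingHom ℂ)))
          (CEval.Square.benchmark L)).Finite ∧
      ((CEval.subdivisionTree (CEval.sqFreeCEVAL (p.map (Int.castRingHom ℂ)))
          (CEval.Square.benchmark L)).ncard : ℝ) ≤
        C * (p.natDegree : ℝ) ^ 2 * ((L : ℝ) + Real.log (p.natDegree : ℝ)) := by
  -- The final estimate needs `2 * 64 * 468 = 59904`.
  refine ⟨60000, fun L p hL hsq hsq' => ?_⟩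
  have hnd : (p.map (Int.castRingHom ℂ)).natDegree = p.natDegree :=
    natDegree_map_eq_of_injective (RingHom.injective_int _) p
  have hlcf : (p.map (Int.castRingHom ℂ)).leadingCoeff = (p.leadingCoeff : ℂ) := by
    rw [leadingCoeff_map_of_injective (RingHom.injective_int _)]; rfl
  have hroots := CEval.exists_fin_roots (p.map (Int.castRingHom ℂ))
  rw [hlcf, hnd] at hroots
  have hd0 : p.natDegree ≠ 0 := fun h => hsq'.ne_zero (derivative_eq_zero.mpr (hnd.trans h))
  have hp0 : p ≠ 0 := fun h => hd0 (by rw [h, natDegree_zero])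
  have hlc0 : (p.leadingCoeff : ℂ) ≠ 0 := by
    rw [Int.cast_ne_zero, leadingCoeff_ne_zero]; exact hp0
  -- For `L = 0` all coefficients would vanish.
  have hL1 : 1 ≤ L := by
    by_contra! h
    have h1 := hL p.natDegree
    have h2 := Int.one_le_abs (leadingCoeff_ne_zero.mpr hp0)
    rw [Nat.lt_one_iff.mp h, pow_zero] at h1
    exact absurd h2 (not_le.mpr h1)
  generalize hfd : p.map (Int.castRingHom ℂ) = f at *
  generalize hd : p.natDegree = d at *
  obtain ⟨α, hr, hf⟩ := hroots
  have hα := CEval.injective_of_squarefree hsq hr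
  have hd1 : (1 : ℝ) ≤ d := by exact_mod_cast Nat.one_le_iff_ne_zero.mpr hd0
  have hL1' : (1 : ℝ) ≤ L := by exact_mod_cast hL1
  have hld : 0 ≤ Real.log d := Real.log_nonneg hd1
  choose s hs0 hsd hs hsep using CEval.exists_separation hα
  have hlogs := CEval.neg_sum_log_separation_le hL hd hd0 (by rw [hfd]; exact hr)
    (by rw [hfd]; exact hf) hα hL1 hsd hs
  let ρ : Fin d → ℝ := fun i => s i / (30 * d ^ 2)
  have hρ0 : ∀ i, 0 < ρ i := fun i => by have := hs0 i; positivity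
  have hρ1 : ∀ i, ρ i ≤ 1 := fun i => by
    have h1 : s i ≤ 1 := (hsd i).trans (by rw [div_le_one (by positivity)]; exact hd1)
    refine div_le_one_of_le₀ (h1.trans ?_) (by positivity)
    nlinarith
  let F : ℂ → ℝ := fun z => 64 * (d * ∑ i, ((max ‖z - α i‖ (ρ i)) ^ 2)⁻¹)
  have hFc : Continuous F := continuous_const.mul (continuous_const.mul
    (continuous_finsetSum _ fun i _ => CEval.continuous_inv_sq_max (α i) (hρ0 i)))
  have hFM : ∀ z, F z ≤ 64 * (d * ∑ i, ((ρ i) ^ 2)⁻¹) := fun z => by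
    simp only [F]
    gcongr with i
    · have := hρ0 i; positivity
    · exact (hρ0 i).le
    · exact le_max_right _ _
  have hB : ∀ S : CEval.Square, 0 < S.width → ¬ CEval.sqFreeCEVAL f S → ∀ z ∈ S.cell,
      ((S.width / 2) ^ 2)⁻¹ ≤ F z := by
    intro S hS hBS z hz
    by_contra! hlt
    apply hBS
    have hsmall : S.width ^ 2 * (d * ∑ i, ((max ‖z - α i‖ (ρ i)) ^ 2)⁻¹) < 1 / 16 := by
      have h1 := mul_lt_mul_of_pos_right hlt (by positivity : 0 < (S.width / 2) ^ 2)
      rw [inv_mul_cancel₀ (by positivity)] at h1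
      simp only [F] at h1
      linarith
    -- If no truncation is active, the exclusion test applies. Otherwise the truncated term at a
    -- near root alone forces `S.width ≤ ρ i / 4`.
    by_cases hfar : ∀ i, ρ i ≤ ‖z - α i‖
    · left
      refine CEval.taylorTest_of_far hlc0 hf hS hz (fun i h => ?_) ?_
      · have := hfar i
        rw [h, sub_self, norm_zero] at this
        exact (hρ0 i).not_ge this
      · simpa only [max_eq_left (hfar _)] using hsmall
    · right
      push Not at hfar
      obtain ⟨i, hi⟩ := hfar
      have h1 : ((ρ i) ^ 2)⁻¹ ≤ d * ∑ i, ((max ‖z - α i‖ (ρ i)) ^ 2)⁻¹ := by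
        have h2 := Finset.single_le_sum (f := fun i => ((max ‖z - α i‖ (ρ i)) ^ 2)⁻¹)
          (fun j _ => by positivity) (Finset.mem_univ i)
        simp only [max_eq_right hi.le] at h2
        exact h2.trans (le_mul_of_one_le_left (Finset.sum_nonneg fun j _ => by positivity) hd1)
      have h2 : S.width ^ 2 * ((ρ i) ^ 2)⁻¹ < 1 / 16 := (by gcongr : _ ≤ _).trans_lt hsmall
      have hw : S.width ≤ ρ i / 4 := by
        have hρi := hρ0 i
        rw [← div_eq_mul_inv, div_lt_iff₀ (by positivity)] at h2
        refine le_of_lt (lt_of_pow_lt_pow_left₀ 2 (by positivity) ?_)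
        linarith
      exact CEval.taylorTest_derivative_of_near hlc0 hf hnd (hs0 i) (hsep i) rfl hS hw hz hi.le
  have hRw : (CEval.Square.benchmark L).width = 2 ^ (L + 1) := rfl
  have hR0 : 0 < (CEval.Square.benchmark L).width := by rw [hRw]; positivity
  obtain ⟨hfin, hcard⟩ := CEval.subdivisionTree_amortization hFc hFM hB hR0
  refine ⟨hfin, ?_⟩
  have hX : 1 ≤ (d : ℝ) ^ 2 * (L + Real.log d) :=
    one_le_mul_of_one_le_of_one_le (one_le_pow₀ hd1) (by linarith)
  -- A terminal root square is treated apart, since the bound `1 ≤ ∫ F` is obtained from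
  -- nonterminality.
  by_cases hBR : CEval.sqFreeCEVAL f (CEval.Square.benchmark L)
  · rw [CEval.subdivisionTree_of_terminal hBR, Set.ncard_singleton]
    push_cast
    linarith
  have hvol := CEval.volume_real_cell hR0.le
  have hone : 1 ≤ ∫ z in (CEval.Square.benchmark L).cell, F z := by
    have h := MeasureTheory.setIntegral_ge_of_const_le_real (CEval.measurableSet_reProdIm_Ico _ _ _ _)
      (CEval.volume_cell_ne_top _) (hB _ hR0 hBR) (CEval.integrableOn_reProdIm_Ico hFc _ _ _ _)
    refine le_trans ?_ h
    change 1 ≤ _ * MeasureTheory.volume.real (CEval.Square.benchmark L).cell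
    rw [hvol]
    field_simp
    norm_num
  have hint : ∀ i, ∫ z in (CEval.Square.benchmark L).cell, ((max ‖z - α i‖ (ρ i)) ^ 2)⁻¹ ≤
      180 * L + 64 * Real.log d - 32 * Real.log (s i) := by
    intro i
    obtain ⟨K, hK, hKL⟩ := CEval.exists_dyadic_scale L (hρ0 i) (hρ1 i)
    have h := CEval.integral_inv_sq_max_le (α i) (hρ0 i) (by positivity) hK
      (CEval.volume_cell_ne_top (CEval.Square.benchmark L))
      (CEval.integrableOn_reProdIm_Ico (CEval.continuous_inv_sq_max (α i) (hρ0 i)) _ _ _ _)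
    have hv : MeasureTheory.volume.real (CEval.Square.benchmark L).cell * (((2 : ℝ) ^ L) ^ 2)⁻¹ = 4 := by
      rw [hvol, hRw]
      field_simp
      ring
    have hlogρ : -Real.log (ρ i) ≤ -Real.log (s i) + 4 + 2 * Real.log d := by
      have hsi := hs0 i
      have h30 : Real.log 30 ≤ 4 := by
        calc Real.log 30 ≤ Real.log (2 ^ 5) := Real.log_le_log (by norm_num) (by norm_num)
          _ = 5 * Real.log 2 := by rw [Real.log_pow]; norm_num
          _ ≤ 4 := by have := Real.log_two_lt_d9; linarith
      simp only [ρ]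
      rw [Real.log_div hsi.ne' (by positivity), Real.log_mul (by norm_num) (by positivity),
        Real.log_pow]
      push_cast
      linarith
    have hpi : (K + 1 : ℝ) * (4 * Real.pi) ≤ (K + 1) * 16 := by
      gcongr
      linarith [Real.pi_le_four]
    rw [hv] at h
    linarith
  have htot : ∫ z in (CEval.Square.benchmark L).cell, F z ≤
      64 * (d * ∑ i, (180 * L + 64 * Real.log d - 32 * Real.log (s i))) := by
    simp only [F]
    rw [MeasureTheory.integral_const_mul, MeasureTheory.integral_const_mul,
      MeasureTheory.integral_finsetSum]
    · gcongr with i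
      exact hint i
    · exact fun i _ => CEval.integrableOn_reProdIm_Ico
        (CEval.continuous_inv_sq_max (α i) (hρ0 i)) _ _ _ _
  -- `468 = 180 + 32 * 9`, the 9 coming from the separation bound.
  have hsum : ∑ i, (180 * L + 64 * Real.log d - 32 * Real.log (s i)) ≤
      468 * (d * (L + Real.log d)) := by
    rw [Finset.sum_sub_distrib, ← Finset.mul_sum, Finset.sum_const, Finset.card_univ,
      Fintype.card_fin, nsmul_eq_mul]
    have : 0 ≤ (d : ℝ) * Real.log d := by positivity
    linarith
  have hfinal : ∫ z in (CEval.Square.benchmark L).cell, F z ≤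
      64 * (d * (468 * (d * (L + Real.log d)))) := htot.trans (by gcongr)
  linarith [hcard hone]
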